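/- Let $p \ge 0$ and $n \ge 1$ be integers, and let $\|\cdot\|_2$ be the Euclidean norm on $\mathbb{R}^p$. Let $f_p : \mathbb{R}^p \to \mathbb{R}$ be Lipschitz with constant $L_p > 0$ with respect to $\|\cdot\|_2$ (no convexity is assumed). Let $\gamma > 0$ and let $X$ be a strongly $\gamma$-log-concave random vector in $\mathbb{R}^p$, that is, $X$ has a Lebesgue density of the form $\phi(x) = \exp[-\psi(x)]$ with $\psi : \mathbb{R}^p \to \mathbb{R}$ satisfying $$\lambda\psi(x) + (1-\lambda)\psi(y) - \psi(\lambda x + (1-\lambda) y) \ \ge\ \frac{\gamma}{2}\,\lambda(1-\lambda)\,\|x-y\|_2^2 \qquad \text{for all } \lambda \in [0,1],\ x, y \in \mathbb{R}^p .$$ Let $X_1, \dots, X_n$ be independent and identically distributed copies of $X$. Then $f_p(X)$ is integrable, and: (i) for every $\delta \ge 0$, $$\mathbb{P}\left\{ \left| \frac1n\sum_{i=1}^n f_p(X_i) - E[f_p(X)] \right| > \delta \right\} \le 2\exp\left(-\frac{\gamma\delta^2 n}{4L_p^2}\right);$$ (ii) for every $0 < \alpha < 1$, the open interval $$\left( \frac1n\sum_{i=1}^n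 f_p(X_i) - \sqrt{\frac{4\log(2/\alpha)L_p^2}{\gamma n}},\ \ \frac1n\sum_{i=1}^n f_p(X_i) + \sqrt{\frac{4\log(2/\alpha)L_p^2}{\gamma n}} \right)$$ contains $E[f_p(X)]$ with probability at least $1-\alpha$; (iii) if $E[f_p(X)] \ne 0$, then for every $\delta \ge 0$, $$\mathbb{P}\left\{ \left| \frac{\frac1n\sum_{i=1}^n f_p(X_i) - E[f_p(X)]}{E[f_p(X)]} \right| > \delta \right\} \le 2\exp\left(-\frac{\gamma\delta^2 n\, E[f_p(X)]^2}{4L_p^2}\right).$$ -/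

import Mathlib

open MeasureTheory ProbabilityTheory

/-- The random vector `X`, defined on `(Ω, P)` with values in Euclidean space `ℝᵖ`, is strongly
`γ`-log-concave: `γ > 0` and `X` has a density `exp (-ψ x)` with respect to Lebesgue measure,
where `ψ : ℝᵖ → ℝ` is strongly convex with parameter `γ` on the whole space, that is,
`ψ (a • x + b • y) ≤ a * ψ x + b * ψ y - a * b * (γ / 2 * ‖x - y‖ ^ 2)`
for all `x`, `y` and all `a, b ≥ 0` with `a + b = 1`. -/
def IsStronglyLogConcave {Ω : Type*} [MeasurableSpace Ω] {p : ℕ} (γ : ℝ)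
    (X : Ω → EuclideanSpace ℝ (Fin p)) (P : Measure Ω) : Prop :=
  0 < γ ∧ ∃ ψ : EuclideanSpace ℝ (Fin p) → ℝ,
    StrongConvexOn Set.univ γ ψ ∧
    HasLaw X (volume.withDensity fun x => ENNReal.ofReal (Real.exp (-ψ x))) P

open scoped ENNReal Pointwise

/-! The heart is Maurey's argument. The midpoint Prékopa–Leindler inequality is applied to `exp (t f
- ψ)`, `exp (-t f - ψ)` and a constant multiple of `exp (-ψ)`. At a midpoint the strong convexity of
`ψ` gains a multiple of `‖x - y‖ ^ 2`, which absorbs the Lipschitz bound on `t (f x - f y)`. Hence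
`E exp (t f) * E exp (-t f) ≤ exp (t² L² / γ)`, with no convexity of `f`. Once `f` is centred,
Jensen makes the second factor at least one, so `f (X)` is sub-Gaussian with variance proxy `2 L² /
γ`; independence and Chernoff's bound do the rest.

Prékopa–Leindler itself comes from Brunn–Minkowski on the line, applied to superlevel sets, followed
by induction on the dimension. -/

/-! ### Brunn–Minkowski on the line -/

/-- The one-dimensional Brunn–Minkowski inequality for compact sets. -/
theorem volume_add_volume_le_volume_add_of_isCompact {K M : Set ℝ} (hK : IsCompact K)
    (hM : IsCompact M) (hKne : K.Nonempty) (hMne : M.Nonempty) :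
    volume K + volume M ≤ volume (K + M) := by
  obtain ⟨a, haK, ha⟩ := hK.exists_isGreatest hKne
  obtain ⟨b, hbM, hb⟩ := hM.exists_isLeast hMne
  -- With `a = max K` and `b = min M`, one translate lies to the left of `a + b` and the other to
  -- the right.
  have hsub : (b +ᵥ K) ∪ (a +ᵥ M) ⊆ K + M := by
    rintro z (⟨x, hx, rfl⟩ | ⟨y, hy, rfl⟩)
    · exact ⟨x, hx, b, hbM, add_comm _ _⟩
    · exact ⟨a, haK, y, hy, rfl⟩
  have hnull : volume ((b +ᵥ K) ∩ (a +ᵥ M)) = 0 := by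
    refine measure_mono_null (t := {a + b}) ?_ (measure_singleton _)
    rintro z ⟨⟨x, hx, hxz⟩, ⟨y, hy, hyz⟩⟩
    simp only [vadd_eq_add] at hxz hyz
    have h1 := ha hx
    have h2 := hb hy
    simp only [Set.mem_singleton_iff]
    linarith
  have hmeas : MeasurableSet (a +ᵥ M) := (hM.vadd a).measurableSet
  calc volume K + volume M = volume (b +ᵥ K) + volume (a +ᵥ M) := by
        rw [measure_vadd, measure_vadd]
    _ = volume ((b +ᵥ K) ∪ (a +ᵥ M)) := (measure_union₀ hmeas.nullMeasurableSet hnull).symm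
    _ ≤ volume (K + M) := measure_mono hsub

/-- The one-dimensional Brunn–Minkowski inequality for measurable sets. -/
theorem volume_add_volume_le_volume_add {A B : Set ℝ} (hA : MeasurableSet A)
    (hB : MeasurableSet B) (hAne : A.Nonempty) (hBne : B.Nonempty) :
    volume A + volume B ≤ volume (A + B) := by
  obtain ⟨a, ha⟩ := hAne
  obtain ⟨b, hb⟩ := hBne
  rw [hA.measure_eq_iSup_isCompact, hB.measure_eq_iSup_isCompact]
  simp only [iSup_and']
  refine ENNReal.biSup_add_biSup_le' (p := fun K => K ⊆ A ∧ IsCompact K)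
    (q := fun M => M ⊆ B ∧ IsCompact M) ⟨∅, by simp⟩ ⟨∅, by simp⟩ ?_
  rintro K ⟨hKA, hK⟩ M ⟨hMB, hM⟩
  -- The compact sets may be empty; adjoining `a` and `b` makes them nonempty.
  calc volume K + volume M ≤ volume (insert a K) + volume (insert b M) :=
        add_le_add (measure_mono (Set.subset_insert _ _)) (measure_mono (Set.subset_insert _ _))
    _ ≤ volume (insert a K + insert b M) :=
        volume_add_volume_le_volume_add_of_isCompact (hK.insert a) (hM.insert b)
          (Set.insert_nonempty _ _) (Set.insert_nonempty _ _)
    _ ≤ volume (A + B) := measure_mono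
        (Set.add_subset_add (Set.insert_subset ha hKA) (Set.insert_subset hb hMB))

/-! ### Prékopa–Leindler on the line -/

/-- AM–GM, which turns the additive inequality into the multiplicative one. -/
theorem ENNReal.four_mul_le_sq_add (u v : ℝ≥0∞) : 4 * (u * v) ≤ (u + v) ^ 2 := by
  by_cases hu : u = ∞
  · simp [hu]
  by_cases hv : v = ∞
  · simp [hv]
  lift u to NNReal using hu
  lift v to NNReal using hv
  norm_cast
  rw [← mul_assoc]
  exact _root_.four_mul_le_sq_add u v

/-- Midpoint Prékopa–Leindler inequality on the line, in its additive form for functions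
of supremum one. -/
theorem lintegral_add_lintegral_le_of_mul_le_sq_midpoint {f g h : ℝ → ℝ} (hf : Measurable f)
    (hg : Measurable g) (hh : Measurable h) (hf0 : ∀ x, 0 ≤ f x) (hg0 : ∀ x, 0 ≤ g x)
    (hh0 : ∀ x, 0 ≤ h x) (hf1 : IsLUB (Set.range f) 1) (hg1 : IsLUB (Set.range g) 1)
    (hfg : ∀ x y, f x * g y ≤ h ((2 : ℝ)⁻¹ • (x + y)) ^ 2) :
    (∫⁻ x, ENNReal.ofReal (f x)) + ∫⁻ x, ENNReal.ofReal (g x)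
      ≤ 2 * ∫⁻ x, ENNReal.ofReal (h x) := by
  have hanti (k : ℝ → ℝ) : Measurable fun t : ℝ => volume {x | t < k x} :=
    Antitone.measurable fun s t hst => measure_mono fun x (hx : t < k x) => hst.trans_lt hx
  rw [lintegral_eq_lintegral_meas_lt _ (.of_forall hf0) hf.aemeasurable,
    lintegral_eq_lintegral_meas_lt _ (.of_forall hg0) hg.aemeasurable,
    lintegral_eq_lintegral_meas_lt _ (.of_forall hh0) hh.aemeasurable,
    ← lintegral_add_left (hanti f), ← lintegral_const_mul _ (hanti h)]
  refine setLIntegral_mono (by fun_prop (disch := exact hanti h)) fun t (ht : 0 < t) => ?_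
  -- Brunn–Minkowski needs nonempty sets. As both suprema are one, the superlevel sets of `f` and
  -- `g` are both nonempty for `t < 1` and both empty for `t ≥ 1`.
  rcases lt_or_ge t 1 with ht1 | ht1
  · obtain ⟨_, ⟨x₀, rfl⟩, hx₀⟩ := (lt_isLUB_iff hf1).1 ht1
    obtain ⟨_, ⟨y₀, rfl⟩, hy₀⟩ := (lt_isLUB_iff hg1).1 ht1
    have hsub : {x | t < f x} + {x | t < g x} ⊆ (2 : ℝ) • {x | t < h x} := by
      rintro _ ⟨x, hx, y, hy, rfl⟩
      refine (Set.mem_smul_set_iff_inv_smul_mem₀ two_ne_zero _ _).2 ?_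
      have h1 := hfg x y
      have h2 : t * t < f x * g y := mul_lt_mul'' hx hy ht.le ht.le
      exact lt_of_pow_lt_pow_left₀ 2 (hh0 _) (by nlinarith)
    calc volume {x | t < f x} + volume {x | t < g x}
        ≤ volume ({x | t < f x} + {x | t < g x}) :=
          volume_add_volume_le_volume_add (measurableSet_lt measurable_const hf)
            (measurableSet_lt measurable_const hg) ⟨x₀, hx₀⟩ ⟨y₀, hy₀⟩
      _ ≤ volume ((2 : ℝ) • {x | t < h x}) := measure_mono hsub
      _ = 2 * volume {x | t < h x} := by
          rw [Measure.addHaar_smul]; simp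
  · have h1 : {x | t < f x} = ∅ := Set.eq_empty_of_forall_notMem fun x hx =>
      absurd ((hf1.1 ⟨x, rfl⟩).trans ht1) (not_le.2 hx)
    have h2 : {x | t < g x} = ∅ := Set.eq_empty_of_forall_notMem fun x hx =>
      absurd ((hg1.1 ⟨x, rfl⟩).trans ht1) (not_le.2 hx)
    simp [h1, h2]

/-- Midpoint Prékopa–Leindler inequality on the line, for bounded functions. -/
theorem lintegral_mul_lintegral_le_of_bddAbove {f g h : ℝ → ℝ} (hf : Measurable f)
    (hg : Measurable g) (hh : Measurable h) (hf0 : ∀ x, 0 ≤ f x) (hg0 : ∀ x, 0 ≤ g x)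
    (hh0 : ∀ x, 0 ≤ h x) (hfb : BddAbove (Set.range f)) (hgb : BddAbove (Set.range g))
    (hfg : ∀ x y, f x * g y ≤ h ((2 : ℝ)⁻¹ • (x + y)) ^ 2) :
    (∫⁻ x, ENNReal.ofReal (f x)) * ∫⁻ x, ENNReal.ofReal (g x)
      ≤ (∫⁻ x, ENNReal.ofReal (h x)) ^ 2 := by
  have hnull {k : ℝ → ℝ} (hkb : BddAbove (Set.range k)) (hk : sSup (Set.range k) ≤ 0) :
      ∫⁻ x, ENNReal.ofReal (k x) = 0 := by
    have : ∀ x, ENNReal.ofReal (k x) = 0 := fun x =>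
      ENNReal.ofReal_of_nonpos ((le_csSup hkb ⟨x, rfl⟩).trans hk)
    simp [this]
  rcases le_or_gt (sSup (Set.range f)) 0 with ha | ha
  · simp [hnull hfb ha]
  rcases le_or_gt (sSup (Set.range g)) 0 with hb | hb
  · simp [hnull hgb hb]
  have hlub {k : ℝ → ℝ} (hkb : BddAbove (Set.range k)) (hk : 0 < sSup (Set.range k)) :
      IsLUB (Set.range fun x => (sSup (Set.range k))⁻¹ * k x) 1 := by
    have h1 := (isLUB_csSup (Set.range_nonempty k) hkb).mul_left (inv_nonneg.2 hk.le)
    rw [inv_mul_cancel₀ hk.ne', ← Set.range_comp] at h1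
    exact h1
  set a := sSup (Set.range f)
  set b := sSup (Set.range g)
  -- Dividing `h` by `√(a * b)` preserves the midpoint hypothesis.
  have key := lintegral_add_lintegral_le_of_mul_le_sq_midpoint
    (f := fun x => a⁻¹ * f x) (g := fun x => b⁻¹ * g x) (h := fun x => (√(a * b))⁻¹ * h x)
    (by fun_prop) (by fun_prop) (by fun_prop)
    (fun x => mul_nonneg (by positivity) (hf0 x)) (fun x => mul_nonneg (by positivity) (hg0 x))
    (fun x => mul_nonneg (by positivity) (hh0 x)) (hlub hfb ha) (hlub hgb hb)
    (fun x y => by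
      rw [mul_pow, inv_pow, Real.sq_sqrt (by positivity), mul_inv]
      have := mul_le_mul_of_nonneg_left (hfg x y) (show 0 ≤ a⁻¹ * b⁻¹ by positivity)
      linarith)
  have hscale {c : ℝ} (hc : 0 < c) {k : ℝ → ℝ} (hk : Measurable k) :
      ∫⁻ x, ENNReal.ofReal (c⁻¹ * k x)
        = (ENNReal.ofReal c)⁻¹ * ∫⁻ x, ENNReal.ofReal (k x) := by
    rw [← lintegral_const_mul _ (by fun_prop)]
    simp_rw [ENNReal.ofReal_mul (inv_nonneg.2 hc.le), ENNReal.ofReal_inv_of_pos hc]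
  have hab : 0 < √(a * b) := by positivity
  rw [hscale ha hf, hscale hb hg, hscale hab hh] at key
  have hsq : ENNReal.ofReal (√(a * b)) ^ 2 = ENNReal.ofReal a * ENNReal.ofReal b := by
    rw [← ENNReal.ofReal_pow hab.le, Real.sq_sqrt (by positivity), ENNReal.ofReal_mul ha.le]
  have hA0 : ENNReal.ofReal a ≠ 0 := by simpa using ha
  have hB0 : ENNReal.ofReal b ≠ 0 := by simpa using hb
  have hS0 : ENNReal.ofReal (√(a * b)) ≠ 0 := by simpa using hab
  generalize (∫⁻ x, ENNReal.ofReal (f x)) = F at *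
  generalize (∫⁻ x, ENNReal.ofReal (g x)) = G at *
  generalize (∫⁻ x, ENNReal.ofReal (h x)) = H at *
  have hA1 : ENNReal.ofReal a ≠ ∞ := ENNReal.ofReal_ne_top
  have hB1 : ENNReal.ofReal b ≠ ∞ := ENNReal.ofReal_ne_top
  have hS1 : ENNReal.ofReal (√(a * b)) ≠ ∞ := ENNReal.ofReal_ne_top
  generalize ENNReal.ofReal a = A at *
  generalize ENNReal.ofReal b = B at *
  generalize ENNReal.ofReal (√(a * b)) = S at *
  have h4 : 4 * ((A⁻¹ * F) * (B⁻¹ * G)) ≤ 4 * (S⁻¹ * H) ^ 2 :=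
    calc 4 * ((A⁻¹ * F) * (B⁻¹ * G)) ≤ (A⁻¹ * F + B⁻¹ * G) ^ 2 := ENNReal.four_mul_le_sq_add _ _
      _ ≤ (2 * (S⁻¹ * H)) ^ 2 := by gcongr
      _ = 4 * (S⁻¹ * H) ^ 2 := by ring
  have h5 := (ENNReal.mul_le_mul_iff_right (by norm_num) (by norm_num)).1 h4
  calc F * G = (A * A⁻¹) * (B * B⁻¹) * (F * G) := by
        rw [ENNReal.mul_inv_cancel hA0 hA1, ENNReal.mul_inv_cancel hB0 hB1]; simp
    _ = S ^ 2 * ((A⁻¹ * F) * (B⁻¹ * G)) := by rw [hsq]; ring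
    _ ≤ S ^ 2 * (S⁻¹ * H) ^ 2 := by gcongr
    _ = (S * S⁻¹) ^ 2 * H ^ 2 := by ring
    _ = H ^ 2 := by rw [ENNReal.mul_inv_cancel hS0 hS1]; simp

/-- Midpoint Prékopa–Leindler inequality on the line. -/
theorem lintegral_mul_lintegral_le_sq_lintegral_real {F G H : ℝ → ℝ≥0∞} (hF : Measurable F)
    (hG : Measurable G) (hH : Measurable H)
    (hFG : ∀ x y, F x * G y ≤ H ((2 : ℝ)⁻¹ • (x + y)) ^ 2) :
    (∫⁻ x, F x) * ∫⁻ x, G x ≤ (∫⁻ x, H x) ^ 2 := by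
  have hfin (K : ℝ → ℝ≥0∞) (N : ℕ) (x : ℝ) : min (K x) N ≠ ∞ :=
    ((min_le_right _ _).trans_lt (ENNReal.natCast_lt_top N)).ne
  -- Truncating all three functions at `N` preserves the hypothesis: where `H ≥ N`, the right side
  -- is `N ^ 2`.
  have htrunc (N : ℕ) : (∫⁻ x, min (F x) N) * ∫⁻ x, min (G x) N ≤ (∫⁻ x, H x) ^ 2 := by
    have hbdd (K : ℝ → ℝ≥0∞) : BddAbove (Set.range fun x => (min (K x) N).toReal) := by
      refine ⟨N, ?_⟩
      rintro _ ⟨x, rfl⟩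
      simpa using ENNReal.toReal_mono (ENNReal.natCast_ne_top N) (min_le_right (K x) (N : ℝ≥0∞))
    have key := lintegral_mul_lintegral_le_of_bddAbove
      (f := fun x => (min (F x) N).toReal) (g := fun x => (min (G x) N).toReal)
      (h := fun x => (min (H x) N).toReal) (by fun_prop) (by fun_prop) (by fun_prop)
      (fun _ => ENNReal.toReal_nonneg) (fun _ => ENNReal.toReal_nonneg)
      (fun _ => ENNReal.toReal_nonneg) (hbdd F) (hbdd G) (fun x y => by
        rw [← ENNReal.toReal_mul, ← ENNReal.toReal_pow]
        refine ENNReal.toReal_mono (ENNReal.pow_ne_top (hfin H N _)) ?_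
        rcases le_total (H ((2 : ℝ)⁻¹ • (x + y))) N with h | h
        · rw [min_eq_left h]
          exact (mul_le_mul' (min_le_left _ _) (min_le_left _ _)).trans (hFG x y)
        · rw [min_eq_right h, sq]
          exact mul_le_mul' (min_le_right _ _) (min_le_right _ _))
    simp_rw [ENNReal.ofReal_toReal (hfin _ N _)] at key
    exact key.trans (pow_le_pow_left' (lintegral_mono fun x => min_le_left _ _) 2)
  have hlim {K : ℝ → ℝ≥0∞} (hK : Measurable K) :
      Filter.Tendsto (fun N : ℕ => ∫⁻ x, min (K x) N) Filter.atTop (nhds (∫⁻ x, K x)) := by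
    refine lintegral_tendsto_of_tendsto_of_monotone (fun N => by fun_prop)
      (.of_forall fun x => fun N M hNM => min_le_min_left _ (by exact_mod_cast hNM))
      (.of_forall fun x => ?_)
    simpa using (tendsto_const_nhds (x := K x)).min ENNReal.tendsto_nat_nhds_top
  -- Excluding zero integrals avoids `0 * ∞` in the limit of the product.
  by_cases hF0 : ∫⁻ x, F x = 0
  · simp [hF0]
  by_cases hG0 : ∫⁻ x, G x = 0
  · simp [hG0]
  exact le_of_tendsto' (ENNReal.Tendsto.mul (hlim hF) (.inl hF0) (hlim hG) (.inl hG0)) htrunc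

/-! ### Prékopa–Leindler in higher dimension -/

/-- Midpoint Prékopa–Leindler inequality on `Fin n → ℝ`. -/
theorem lintegral_mul_lintegral_le_sq_lintegral_pi {n : ℕ} {F G H : (Fin n → ℝ) → ℝ≥0∞}
    (hF : Measurable F) (hG : Measurable G) (hH : Measurable H)
    (hFG : ∀ x y, F x * G y ≤ H ((2 : ℝ)⁻¹ • (x + y)) ^ 2) :
    (∫⁻ x, F x) * ∫⁻ x, G x ≤ (∫⁻ x, H x) ^ 2 := by
  induction n with
  | zero =>
    simp only [Measure.volume_pi_eq_dirac (default : Fin 0 → ℝ), lintegral_dirac]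
    convert hFG default default
  | succ n ih =>
    have hsplit {K : (Fin (n + 1) → ℝ) → ℝ≥0∞} (hK : Measurable K) :
        ∫⁻ x, K x = ∫⁻ a : ℝ, ∫⁻ x : Fin n → ℝ, K (Fin.cons a x) := by
      rw [← ((volume_preserving_piFinSuccAbove (fun _ : Fin (n + 1) => ℝ) 0).symm _).lintegral_comp
        hK, Measure.volume_eq_prod, lintegral_prod _ (by fun_prop)]
      simp [MeasurableEquiv.piFinSuccAbove_symm_apply, Fin.insertNthEquiv]
    have hcons : Measurable fun z : ℝ × (Fin n → ℝ) => (Fin.cons z.1 z.2 : Fin (n + 1) → ℝ) := by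
      refine measurable_pi_iff.2 fun i => ?_
      refine Fin.cases ?_ (fun j => ?_) i
      · simpa using measurable_fst
      · simpa [Function.comp_def] using (measurable_pi_apply j).comp measurable_snd
    have hmeas {K : (Fin (n + 1) → ℝ) → ℝ≥0∞} (hK : Measurable K) :
        Measurable fun a : ℝ => ∫⁻ x : Fin n → ℝ, K (Fin.cons a x) :=
      (hK.comp hcons).lintegral_prod_right'
    have hslice {K : (Fin (n + 1) → ℝ) → ℝ≥0∞} (hK : Measurable K) (a : ℝ) :
        Measurable fun x : Fin n → ℝ => K (Fin.cons a x) :=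
      (hK.comp hcons).comp measurable_prodMk_left
    rw [hsplit hF, hsplit hG, hsplit hH]
    -- The marginals in the first coordinate satisfy the one-dimensional hypothesis, by induction on
    -- the slices at `a`, `b` and their midpoint.
    refine lintegral_mul_lintegral_le_sq_lintegral_real (hmeas hF) (hmeas hG) (hmeas hH)
      fun a b => ih (hslice hF a) (hslice hG b) (hslice hH _) fun x y => ?_
    convert! hFG (Fin.cons a x) (Fin.cons b y) using 3
    ext i
    refine Fin.cases ?_ (fun j => ?_) i <;> simp [mul_add]

/-- Midpoint Prékopa–Leindler inequality on Euclidean space. -/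
theorem lintegral_mul_lintegral_le_sq_lintegral {n : ℕ}
    {F G H : EuclideanSpace ℝ (Fin n) → ℝ≥0∞} (hF : Measurable F) (hG : Measurable G)
    (hH : Measurable H) (hFG : ∀ x y, F x * G y ≤ H ((2 : ℝ)⁻¹ • (x + y)) ^ 2) :
    (∫⁻ x, F x) * ∫⁻ x, G x ≤ (∫⁻ x, H x) ^ 2 := by
  have hmp := PiLp.volume_preserving_toLp (Fin n)
  rw [← hmp.lintegral_comp hF, ← hmp.lintegral_comp hG, ← hmp.lintegral_comp hH]
  exact lintegral_mul_lintegral_le_sq_lintegral_pi (hF.comp hmp.measurable)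
    (hG.comp hmp.measurable) (hH.comp hmp.measurable) fun x y => by
      simpa [← WithLp.toLp_add, ← WithLp.toLp_smul] using hFG (WithLp.toLp 2 x) (WithLp.toLp 2 y)

/-! ### Exponential moments and sub-Gaussianity -/

/-- Maurey's inequality: the product of the exponential moments of `t f` and `-t f` for a
Lipschitz function `f` of a strongly log-concave vector. -/
theorem IsStronglyLogConcave.lintegral_exp_mul_lintegral_exp_neg_le
    {p : ℕ} {f : EuclideanSpace ℝ (Fin p) → ℝ} {L : NNReal} (hf : LipschitzWith L f) {γ : ℝ}
    {Ω : Type*} [MeasurableSpace Ω] {P : Measure Ω} [IsProbabilityMeasure P]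
    {X : Ω → EuclideanSpace ℝ (Fin p)} (hX : IsStronglyLogConcave γ X P) (t : ℝ) :
    (∫⁻ ω, ENNReal.ofReal (Real.exp (t * f (X ω))) ∂P)
        * ∫⁻ ω, ENNReal.ofReal (Real.exp (-t * f (X ω))) ∂P
      ≤ ENNReal.ofReal (Real.exp (t ^ 2 * L ^ 2 / γ)) := by
  obtain ⟨hγ, ψ, hψ, hlaw⟩ := hX
  have hψc : Continuous ψ :=
    (ConvexOn.locallyLipschitz (hψ.strictConvexOn hγ).convexOn).continuous
  have hfc : Continuous f := hf.continuous
  have htransfer (k : EuclideanSpace ℝ (Fin p) → ℝ) (hk : Continuous k) :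
      ∫⁻ ω, ENNReal.ofReal (Real.exp (k (X ω))) ∂P
        = ∫⁻ x, ENNReal.ofReal (Real.exp (k x - ψ x)) := by
    have hkm : Measurable fun x => ENNReal.ofReal (Real.exp (k x)) :=
      ENNReal.measurable_ofReal.comp (Real.continuous_exp.comp hk).measurable
    have hψm : Measurable fun x => ENNReal.ofReal (Real.exp (-ψ x)) :=
      ENNReal.measurable_ofReal.comp (Real.continuous_exp.comp hψc.neg).measurable
    rw [hlaw.lintegral_comp (f := fun x => ENNReal.ofReal (Real.exp (k x))) hkm.aemeasurable,
      lintegral_withDensity_eq_lintegral_mul _ hψm hkm]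
    refine lintegral_congr fun x => ?_
    rw [Pi.mul_apply, ← ENNReal.ofReal_mul (Real.exp_nonneg _), ← Real.exp_add]
    congr 2
    ring
  have hmass : ∫⁻ x, ENNReal.ofReal (Real.exp (t ^ 2 * L ^ 2 / (2 * γ) - ψ x))
      = ENNReal.ofReal (Real.exp (t ^ 2 * L ^ 2 / (2 * γ))) := by
    rw [← htransfer (fun _ => t ^ 2 * L ^ 2 / (2 * γ)) continuous_const]
    simp
  have hm (k : EuclideanSpace ℝ (Fin p) → ℝ) (hk : Continuous k) :
      Measurable fun x => ENNReal.ofReal (Real.exp (k x - ψ x)) :=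
    ENNReal.measurable_ofReal.comp (Real.continuous_exp.comp (hk.sub hψc)).measurable
  have key := lintegral_mul_lintegral_le_sq_lintegral (hm (fun x => t * f x) (by fun_prop))
    (hm (fun x => -t * f x) (by fun_prop)) (hm (fun _ => t ^ 2 * L ^ 2 / (2 * γ)) (by fun_prop))
    (fun x y => by
      rw [← ENNReal.ofReal_mul (Real.exp_nonneg _), ← ENNReal.ofReal_pow (Real.exp_nonneg _),
        ← Real.exp_add, ← Real.exp_nat_mul]
      refine ENNReal.ofReal_le_ofReal (Real.exp_le_exp.2 ?_)
      have hconv := hψ.2 (Set.mem_univ x) (Set.mem_univ y)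
        (show (0 : ℝ) ≤ 2⁻¹ by norm_num) (show (0 : ℝ) ≤ 2⁻¹ by norm_num) (by norm_num)
      rw [← smul_add] at hconv
      simp only [smul_eq_mul] at hconv
      have hlip : t * (f x - f y) ≤ |t| * (L * ‖x - y‖) := by
        refine (le_abs_self _).trans ?_
        rw [abs_mul]
        refine mul_le_mul_of_nonneg_left ?_ (abs_nonneg t)
        simpa [Real.dist_eq, dist_eq_norm] using hf.dist_le_mul x y
      have hyoung : |t| * (L * ‖x - y‖) ≤ t ^ 2 * L ^ 2 / γ + γ / 4 * ‖x - y‖ ^ 2 := by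
        -- The coefficient `γ / 4` is twice the midpoint gain `γ / 8`, since `H` enters squared.
        have h1 : 0 ≤ (|t| * L - γ / 2 * ‖x - y‖) ^ 2 / γ := by positivity
        have h2 : (|t| * L - γ / 2 * ‖x - y‖) ^ 2 / γ
            = t ^ 2 * L ^ 2 / γ + γ / 4 * ‖x - y‖ ^ 2 - |t| * (L * ‖x - y‖) := by
          rw [← sq_abs t]
          field_simp
          ring
        linarith
      have hhalf : t ^ 2 * (L : ℝ) ^ 2 / (2 * γ) = t ^ 2 * L ^ 2 / γ / 2 := by
        field_simp
      push_cast
      rw [hhalf]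
      linarith)
  rw [htransfer (fun x => t * f x) (by fun_prop), htransfer (fun x => -t * f x) (by fun_prop)]
  refine key.trans_eq ?_
  rw [hmass, ← ENNReal.ofReal_pow (Real.exp_nonneg _), ← Real.exp_nat_mul]
  congr 2
  push_cast
  field_simp

theorem IsStronglyLogConcave.aemeasurable_comp
    {p : ℕ} {f : EuclideanSpace ℝ (Fin p) → ℝ} (hf : Continuous f) {γ : ℝ}
    {Ω : Type*} [MeasurableSpace Ω] {P : Measure Ω}
    {X : Ω → EuclideanSpace ℝ (Fin p)} (hX : IsStronglyLogConcave γ X P) :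
    AEMeasurable (fun ω => f (X ω)) P := by
  obtain ⟨-, ψ, -, hlaw⟩ := hX
  exact hf.measurable.comp_aemeasurable hlaw.aemeasurable

/-- The product in Maurey's inequality is finite and the other factor is nonzero, so neither moment
can be infinite. -/
theorem IsStronglyLogConcave.integrable_exp_mul
    {p : ℕ} {f : EuclideanSpace ℝ (Fin p) → ℝ} {L : NNReal} (hf : LipschitzWith L f) {γ : ℝ}
    {Ω : Type*} [MeasurableSpace Ω] {P : Measure Ω} [IsProbabilityMeasure P]
    {X : Ω → EuclideanSpace ℝ (Fin p)} (hX : IsStronglyLogConcave γ X P) (t : ℝ) :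
    Integrable (fun ω => Real.exp (t * f (X ω))) P := by
  have hm (s : ℝ) : AEMeasurable (fun ω => Real.exp (s * f (X ω))) P :=
    Real.measurable_exp.comp_aemeasurable ((hX.aemeasurable_comp hf.continuous).const_mul s)
  refine ⟨(hm t).aestronglyMeasurable, ?_⟩
  rw [hasFiniteIntegral_iff_ofReal (.of_forall fun _ => Real.exp_nonneg _)]
  have hpos : ∫⁻ ω, ENNReal.ofReal (Real.exp (-t * f (X ω))) ∂P ≠ 0 := by
    rw [Ne, lintegral_eq_zero_iff' (hm (-t)).ennreal_ofReal]
    intro h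
    obtain ⟨ω, hω⟩ := h.exists
    exact (Real.exp_pos _).not_ge (ENNReal.ofReal_eq_zero.1 hω)
  refine lt_top_iff_ne_top.2 fun htop => ?_
  have key := hX.lintegral_exp_mul_lintegral_exp_neg_le hf t
  rw [htop, ENNReal.top_mul hpos] at key
  exact ENNReal.ofReal_ne_top (top_le_iff.1 key)

theorem IsStronglyLogConcave.integrable_comp
    {p : ℕ} {f : EuclideanSpace ℝ (Fin p) → ℝ} {L : NNReal} (hf : LipschitzWith L f) {γ : ℝ}
    {Ω : Type*} [MeasurableSpace Ω] {P : Measure Ω} [IsProbabilityMeasure P]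
    {X : Ω → EuclideanSpace ℝ (Fin p)} (hX : IsStronglyLogConcave γ X P) :
    Integrable (fun ω => f (X ω)) P := by
  have huniv : integrableExpSet (fun ω => f (X ω)) P = Set.univ :=
    Set.eq_univ_of_forall fun t => hX.integrable_exp_mul hf t
  exact memLp_one_iff_integrable.1
    (by simpa using memLp_of_mem_interior_integrableExpSet (by simp [huniv]) 1)

/-- A centred Lipschitz function of a strongly log-concave vector is sub-Gaussian. -/
theorem IsStronglyLogConcave.hasSubgaussianMGF
    {p : ℕ} {f : EuclideanSpace ℝ (Fin p) → ℝ} {L : NNReal} (hf : LipschitzWith L f) {γ : ℝ}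
    {Ω : Type*} [MeasurableSpace Ω] {P : Measure Ω} [IsProbabilityMeasure P]
    {X : Ω → EuclideanSpace ℝ (Fin p)} (hX : IsStronglyLogConcave γ X P) :
    HasSubgaussianMGF (fun ω => f (X ω) - ∫ ω', f (X ω') ∂P)
      (Real.toNNReal (2 * L ^ 2 / γ)) P := by
  have hγ : 0 < γ := hX.1
  set m := ∫ ω', f (X ω') ∂P
  have hfm : LipschitzWith L fun x => f x - m := by
    simpa using hf.sub (LipschitzWith.const m)
  have hint := hX.integrable_exp_mul hfm
  refine ⟨hint, fun t => ?_⟩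
  -- Jensen's inequality, through `1 + x ≤ exp x` and centring.
  have hone : 1 ≤ ∫ ω, Real.exp (-t * (f (X ω) - m)) ∂P := by
    have hI := hX.integrable_comp hf
    have hI' : Integrable (fun ω => f (X ω) - m) P := hI.sub (integrable_const m)
    calc (1 : ℝ) = ∫ ω, (-t * (f (X ω) - m) + 1) ∂P := by
          rw [integral_add (hI'.const_mul _) (integrable_const 1),
            integral_const_mul, integral_sub hI (integrable_const m)]
          simp [m]
      _ ≤ ∫ ω, Real.exp (-t * (f (X ω) - m)) ∂P :=
          integral_mono ((hI'.const_mul _).add (integrable_const 1))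
            (hint (-t)) fun ω => Real.add_one_le_exp _
  have key := hX.lintegral_exp_mul_lintegral_exp_neg_le hfm t
  rw [← ofReal_integral_eq_lintegral_ofReal (hint t) (.of_forall fun _ => Real.exp_nonneg _),
    ← ofReal_integral_eq_lintegral_ofReal (hint (-t)) (.of_forall fun _ => Real.exp_nonneg _),
    ← ENNReal.ofReal_mul (integral_nonneg fun _ => Real.exp_nonneg _),
    ENNReal.ofReal_le_ofReal_iff (Real.exp_nonneg _)] at key
  have hexp : (Real.toNNReal (2 * L ^ 2 / γ) : ℝ) * t ^ 2 / 2 = t ^ 2 * L ^ 2 / γ := by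
    rw [Real.coe_toNNReal _ (by positivity)]
    field_simp
  rw [hexp]
  exact (le_mul_of_one_le_right (integral_nonneg fun _ => Real.exp_nonneg _) hone).trans key

/-! ### Concentration of the empirical mean -/

/-- Two-sided Hoeffding inequality for the mean of i.i.d. copies of a sub-Gaussian variable. -/
theorem measureReal_le_abs_sum_div_sub_le_of_hasSubgaussianMGF
    {Ω : Type*} [MeasurableSpace Ω] {P : Measure Ω} {n : ℕ} (hn : 1 ≤ n) {Y : Fin n → Ω → ℝ}
    [IsProbabilityMeasure P] {c : NNReal} {m : ℝ} (hindep : iIndepFun Y P)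
    (hsub : ∀ i, HasSubgaussianMGF (fun ω => Y i ω - m) c P) {δ : ℝ} (hδ : 0 ≤ δ) :
    P.real {ω | δ ≤ |(∑ i, Y i ω) / n - m|} ≤ 2 * Real.exp (-(n * δ ^ 2 / (2 * c))) := by
  have hn0 : (0 : ℝ) < n := by exact_mod_cast hn
  have hε : 0 ≤ n * δ := by positivity
  have hexp : -(n * δ) ^ 2 / (2 * ((∑ _i : Fin n, c : NNReal) : ℝ)) = -(n * δ ^ 2 / (2 * c)) := by
    simp only [Finset.sum_const, Finset.card_univ, Fintype.card_fin, nsmul_eq_mul]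
    push_cast
    rw [neg_div, mul_pow, show 2 * ((n : ℝ) * c) = n * (2 * c) by ring, sq (n : ℝ), mul_assoc,
      mul_div_mul_left _ _ hn0.ne']
  have hup := HasSubgaussianMGF.measure_sum_ge_le_of_iIndepFun
    (hindep.comp (fun _ y => y - m) fun _ => measurable_id.sub_const m) (c := fun _ => c)
    (s := Finset.univ) (fun i _ => hsub i) hε
  have hlo := HasSubgaussianMGF.measure_sum_ge_le_of_iIndepFun
    (hindep.comp (fun _ y => -(y - m)) fun _ => (measurable_id.sub_const m).neg) (c := fun _ => c)
    (s := Finset.univ) (fun i _ => (hsub i).neg) hε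
  rw [hexp] at hup hlo
  have hsum (ω : Ω) : ∑ i, (Y i ω - m) = n * ((∑ i, Y i ω) / n - m) := by
    rw [Finset.sum_sub_distrib]
    simp
    field_simp
  calc P.real {ω | δ ≤ |(∑ i, Y i ω) / n - m|}
      ≤ P.real ({ω | n * δ ≤ ∑ i, (Y i ω - m)} ∪ {ω | n * δ ≤ ∑ i, -(Y i ω - m)}) := by
        refine measureReal_mono fun ω (hω : δ ≤ |(∑ i, Y i ω) / n - m|) => ?_
        simp only [Finset.sum_neg_distrib, Set.mem_union, Set.mem_ofPred_eq, hsum, ← mul_neg]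
        exact (le_abs.1 hω).imp (mul_le_mul_of_nonneg_left · hn0.le)
          (mul_le_mul_of_nonneg_left · hn0.le)
    _ ≤ _ := measureReal_union_le _ _
    _ ≤ 2 * Real.exp (-(n * δ ^ 2 / (2 * c))) := by
        rw [two_mul]
        exact add_le_add hup hlo

theorem proposition3
    {p : ℕ} (f : EuclideanSpace ℝ (Fin p) → ℝ) (L : NNReal) (hL : 0 < L)
    (hf : LipschitzWith L f) (γ : ℝ)
    {Ω₀ : Type*} [MeasurableSpace Ω₀] (P₀ : Measure Ω₀) [IsProbabilityMeasure P₀]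
    (X : Ω₀ → EuclideanSpace ℝ (Fin p)) (hX : IsStronglyLogConcave γ X P₀)
    {Ω : Type*} [MeasurableSpace Ω] (P : Measure Ω) [IsProbabilityMeasure P]
    (n : ℕ) (hn : 1 ≤ n) (Xs : Fin n → Ω → EuclideanSpace ℝ (Fin p))
    (hindep : iIndepFun Xs P) (hident : ∀ i, IdentDistrib (Xs i) X P P₀) :
    Integrable (fun ω => f (X ω)) P₀ ∧
    (∀ δ : ℝ, 0 ≤ δ →
      P.real {ω | |(∑ i, f (Xs i ω)) / n - ∫ ω', f (X ω') ∂P₀| > δ}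
        ≤ 2 * Real.exp (-(γ * δ ^ 2 * n / (4 * (L : ℝ) ^ 2)))) ∧
    (∀ α : ℝ, 0 < α → α < 1 →
      1 - α ≤ P.real {ω | ∫ ω', f (X ω') ∂P₀ ∈ Set.Ioo
        ((∑ i, f (Xs i ω)) / n - √(4 * Real.log (2 / α) * (L : ℝ) ^ 2 / (γ * n)))
        ((∑ i, f (Xs i ω)) / n + √(4 * Real.log (2 / α) * (L : ℝ) ^ 2 / (γ * n)))}) ∧
    (∫ ω', f (X ω') ∂P₀ ≠ 0 → ∀ δ : ℝ, 0 ≤ δ →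
      P.real {ω | |((∑ i, f (Xs i ω)) / n - ∫ ω', f (X ω') ∂P₀)
          / ∫ ω', f (X ω') ∂P₀| > δ}
        ≤ 2 * Real.exp
          (-(γ * δ ^ 2 * n * (∫ ω', f (X ω') ∂P₀) ^ 2 / (4 * (L : ℝ) ^ 2)))) := by

  have hγ : 0 < γ := hX.1
  have hL' : (0 : ℝ) < L := by exact_mod_cast hL
  have hn0 : (0 : ℝ) < n := by exact_mod_cast hn
  set m := ∫ ω', f (X ω') ∂P₀
  have hfm : Measurable f := hf.continuous.measurable
  have hsub (i : Fin n) : HasSubgaussianMGF (fun ω => f (Xs i ω) - m)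
      (Real.toNNReal (2 * L ^ 2 / γ)) P :=
    (hX.hasSubgaussianMGF hf).congr_identDistrib
      ((hident i).symm.comp (hfm.sub_const m))
  -- The non-strict event is needed because the interval in (ii) is open.
  have htail (δ : ℝ) (hδ : 0 ≤ δ) : P.real {ω | δ ≤ |(∑ i, f (Xs i ω)) / n - m|}
      ≤ 2 * Real.exp (-(γ * δ ^ 2 * n / (4 * (L : ℝ) ^ 2))) := by
    have h := measureReal_le_abs_sum_div_sub_le_of_hasSubgaussianMGF hn
      (hindep.comp (fun _ => f) fun _ => hfm) hsub hδ
    rw [Real.coe_toNNReal _ (by positivity)] at h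
    refine h.trans_eq ?_
    congr 3
    field_simp
    norm_num
  refine ⟨hX.integrable_comp hf, fun δ hδ => ?_, fun α hα hα1 => ?_, fun hm δ hδ => ?_⟩
  · exact (measureReal_mono fun ω (hω : _ > δ) => hω.le).trans (htail δ hδ)
  · set r := √(4 * Real.log (2 / α) * (L : ℝ) ^ 2 / (γ * n))
    have hlog : 0 ≤ Real.log (2 / α) := Real.log_nonneg (by rw [le_div_iff₀ hα]; linarith)
    have hr := htail r (Real.sqrt_nonneg _)
    -- The radius `r` is chosen to make the tail bound exactly `α`.
    rw [Real.sq_sqrt (by positivity), show γ * (4 * Real.log (2 / α) * (L : ℝ) ^ 2 / (γ * n)) * n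
      / (4 * (L : ℝ) ^ 2) = Real.log (2 / α) by field_simp, Real.exp_neg,
      Real.exp_log (by positivity), show 2 * (2 / α)⁻¹ = α by field_simp] at hr
    have hcover : P.real Set.univ ≤
        P.real {ω | m ∈ Set.Ioo ((∑ i, f (Xs i ω)) / n - r) ((∑ i, f (Xs i ω)) / n + r)}
          + P.real {ω | r ≤ |(∑ i, f (Xs i ω)) / n - m|} := by
      refine (measureReal_mono fun ω _ => ?_).trans (measureReal_union_le _ _)
      rcases le_or_gt r |(∑ i, f (Xs i ω)) / n - m| with h | h
      · exact Or.inr h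
      · have := abs_lt.1 h
        exact Or.inl ⟨by linarith, by linarith⟩
    rw [probReal_univ] at hcover
    linarith
  -- A relative error `δ` is an absolute error `δ * |m|`.
  · have h := htail (δ * |m|) (by positivity)
    rw [mul_pow, sq_abs, show γ * (δ ^ 2 * m ^ 2) * n = γ * δ ^ 2 * n * m ^ 2 by ring] at h
    refine (measureReal_mono fun ω (hω : _ > δ) => ?_).trans h
    rw [abs_div, gt_iff_lt, lt_div_iff₀ (abs_pos.2 hm)] at hω
    exact hω.le
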